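/- Conventions. For equivalence relations $R$ on $X$ and $S$ on $Y$ ($X,Y$ Borel subsets of Polish spaces), $R\le_B S$ means that there is a Borel map $f:X\to Y$ with $x_1\mathrel R x_2\iff f(x_1)\mathrel S f(x_2)$ for all $x_1,x_2\in X$; $R$ is Borel if it is a Borel subset of $X\times X$. The relation $R\times S$ on $X\times Y$ is $(x,y)\mathrel{(R\times S)}(x',y')\iff x\mathrel R x'$ and $y\mathrel S y'$. The Friedman--Stanley jump $R^+$ is the relation on $X^{\mathbb N}$ given by $$x\mathrel{R^+}x'\iff \forall n\,\exists m\ x(n)\mathrel R x'(m)\ \text{ and }\ \forall n\,\exists m\ x'(n)\mathrel R x(m).$$ Let $F=(=_{\mathbb R})^+$ on $\mathbb R^{\mathbb N}$ and $G=(=_{2^{\mathbb N}})^+$ on $(2^{\mathbb N})^{\mathbb N}$. For $(x,y)\in\mathbb R^{\mathbb N}\times(2^{\mathbb N})^{\mathbb N}$ and $n\in\mathbb N$ put $A^{(x,y)}_n=\{x(m): y(n)(m)=1\}$. Let $P$ be the set of all $(x,y)\in\mathbb R^{\mathbb N}\times(2^{\mathbb N})^{\mathbb N}$ such that (1) $\forall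 m\,\exists k\ y(k)(m)=1$; (2) $\forall k\,\exists m\ y(k)(m)=1$; (3) for all $k,l_1,l_2$, if $x(l_1)=x(l_2)$ then $y(k)(l_1)=y(k)(l_2)$. Define $E$ on $P$ by $$(x,y)\mathrel E(x',y')\iff \{A^{(x,y)}_n:n\in\mathbb N\}=\{A^{(x',y')}_n:n\in\mathbb N\}.$$ Theorem. $P$ is a dense $G_\delta$ subset of $\mathbb R^{\mathbb N}\times(2^{\mathbb N})^{\mathbb N}$; $E$, $F$, $G$ are Borel equivalence relations; for $(x,y),(x',y')\in P$, $(x,y)\mathrel E(x',y')$ implies $x\mathrel F x'$; and for every $x_0\in\mathbb R^{\mathbb N}$, $E\restriction\{(x,y)\in P: x\mathrel F x_0\}\le_B G$. Moreover $((=_{\mathbb R})^+)^+\le_B E$, $F\times G\le_B(=_{\mathbb R})^+$ and $((=_{\mathbb R})^+)^+\not\le_B(=_{\mathbb R})^+$, and $E\not\le_B F\times G$. Consequently the following conjecture of Kanovei and Zapletal is false: whenever $X,Y,Z$ are Polish spaces, $P\subseteq X\times Y$ is Borel, $F$, $E$, $G$ are Borel equivalence relations on $X$, $P$, $Z$ respectively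 such that $(x,y)\mathrel E(x',y')$ implies $x\mathrel F x'$ for all $(x,y),(x',y')\in P$, and $E\restriction\{(x,y)\in P: x\mathrel F x_0\}\le_B G$ for every $x_0\in X$, then $E\le_B F\times G$. -/

import Mathlib

namespace KZ

/-- `E` is a Borel equivalence relation: it is a Borel subset of the square of the space. (On the
spaces used here the product σ-algebra is the Borel σ-algebra of the product topology.) -/
def IsBorelEquiv {X : Type*} [MeasurableSpace X] (E : Setoid X) : Prop :=
  MeasurableSet {p : X × X | E p.1 p.2}

/-- Borel reducibility `E ≤_B F`. -/
def BorelReducible {X Y : Type*} [MeasurableSpace X] [MeasurableSpace Y]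
    (E : Setoid X) (F : Setoid Y) : Prop :=
  ∃ f : X → Y, Measurable f ∧ ∀ x₁ x₂ : X, E x₁ x₂ ↔ F (f x₁) (f x₂)

/-- The restriction of an equivalence relation to a subset. -/
def restrict {X : Type*} (E : Setoid X) (A : Set X) : Setoid A :=
  E.comap Subtype.val

/-- The pointwise product of two equivalence relations. -/
def prodRel {X Y : Type*} (F₁ : Setoid X) (F₂ : Setoid Y) : Setoid (X × Y) where
  r p q := F₁ p.1 q.1 ∧ F₂ p.2 q.2
  iseqv :=
    { refl := fun p => ⟨F₁.refl p.1, F₂.refl p.2⟩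
      symm := fun h => ⟨F₁.symm h.1, F₂.symm h.2⟩
      trans := fun h k => ⟨F₁.trans h.1 k.1, F₂.trans h.2 k.2⟩ }

/-- The Friedman-Stanley jump `E⁺` of `E`. -/
def jump {X : Type*} (E : Setoid X) : Setoid (ℕ → X) where
  r x y := (∀ n, ∃ m, E (x n) (y m)) ∧ (∀ n, ∃ m, E (y n) (x m))
  iseqv :=
    { refl := fun x => ⟨fun n => ⟨n, E.refl (x n)⟩, fun n => ⟨n, E.refl (x n)⟩⟩
      symm := fun h => ⟨h.2, h.1⟩
      trans := by
        intro x y z h k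
        constructor
        · intro n
          obtain ⟨m, hm⟩ := h.1 n
          obtain ⟨l, hl⟩ := k.1 m
          exact ⟨l, E.trans hm hl⟩
        · intro n
          obtain ⟨m, hm⟩ := k.2 n
          obtain ⟨l, hl⟩ := h.2 m
          exact ⟨l, E.trans hm hl⟩ }

/-- Equality on a space, as an equivalence relation. -/
def eqRel (X : Type*) : Setoid X where
  r x y := x = y
  iseqv := eq_equivalence

/-- The Kanovei-Zapletal conjecture, for all Polish spaces with their Borel σ-algebras. -/
def KanoveiZapletalConjecture : Prop :=
  ∀ (X Y Z : Type)
    [TopologicalSpace X] [PolishSpace X] [MeasurableSpace X] [BorelSpace X]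
    [TopologicalSpace Y] [PolishSpace Y] [MeasurableSpace Y] [BorelSpace Y]
    [TopologicalSpace Z] [PolishSpace Z] [MeasurableSpace Z] [BorelSpace Z]
    (P : Set (X × Y)) (F : Setoid X) (E : Setoid P) (G : Setoid Z),
    MeasurableSet P → IsBorelEquiv F → IsBorelEquiv E → IsBorelEquiv G →
    (∀ p q : P, E p q → F p.1.1 q.1.1) →
    (∀ x₀ : X, BorelReducible (restrict E {p : P | F p.1.1 x₀}) G) →
    BorelReducible E (prodRel F G)

/-- `F = (=_ℝ)⁺` on `ℝ^ℕ`. -/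
def relF : Setoid (ℕ → ℝ) := jump (eqRel ℝ)

/-- `G = (=_{2^ℕ})⁺` on `(2^ℕ)^ℕ`. -/
def relG : Setoid (ℕ → ℕ → Bool) := jump (eqRel (ℕ → Bool))

/-- The set `A_n^{(x,y)} = {x(m) : y(n)(m) = 1}` of reals. -/
def carve (p : (ℕ → ℝ) × (ℕ → ℕ → Bool)) (n : ℕ) : Set ℝ :=
  {r | ∃ m, p.2 n m = true ∧ p.1 m = r}

/-- The set `P ⊆ ℝ^ℕ × (2^ℕ)^ℕ`. -/
def setP : Set ((ℕ → ℝ) × (ℕ → ℕ → Bool)) :=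
  {p | (∀ m, ∃ k, p.2 k m = true) ∧
       (∀ k, ∃ m, p.2 k m = true) ∧
       (∀ k l₁ l₂, p.1 l₁ = p.1 l₂ → p.2 k l₁ = p.2 k l₂)}

/-- The equivalence relation `E` on `P`: coding the same family of sets of reals. -/
def relE : Setoid setP where
  r p q := Set.range (carve p.1) = Set.range (carve q.1)
  iseqv :=
    { refl := fun _ => rfl
      symm := fun h => h.symm
      trans := fun h k => h.trans k }

end KZ

namespace KZ

open Set Filter Topology

/-! ### Baire category in spaces of arrays of natural numbers -/

/-! A point of $P$ codes a countable family of countable sets of reals whose union is the range of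
$x$. If $x\mathrel F x_0$, every member of the family is named by a subset of the index set of
$x_0$, so on one $F$-class $E$ reduces to $G$. Globally, $E$ is as hard as the double jump of
equality, by flattening a sequence of sequences into $x$. Tagging a disjoint union shows that
$F\times G$ reduces to a single jump. Hence everything rests on `not_jump_jump_reducible_jump`.

For that, let arrays $x,y$ be generic in the sense of Baire category and code the family of graphs
$\{(x_m,y_{n,m}):m\in\mathbb N\}$. A reduction to the jump of equality would assign to $(x,y)$ a
countable set of reals that is unchanged when the indices $m$ and $n$ are relabelled by onto maps.
`eventually_range_subset` shows that such a set does not depend on $y$: for generic $x,y,y'$ it is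
the same for $(x,y)$ and $(x,y')$. The coded families differ, which is a contradiction.

To prove the independence, suppose that a condition (a cylinder) forces the $k$-th value at $(x,y)$
out of the set at $(x,y')$. Under a generic relabelling $w$, some entry $k_2$ for $(x,y,w)$ equals
that value. Copying the relevant part of $y$ into later rows of $y'$ gives a condition deciding a
rational strictly between the $k$-th value at $(x,y)$ and the entry $k_2$ for $(x,y',w)$, and on
which side each lies. This condition is compatible with a permuted copy of itself in which the old
$y$ plays the role of $y'$. One real then lies both below and above the same rational. -/

/-- Reindexing along an injection, followed by permutations of the values, is an open map. -/
theorem isOpenMap_reindex {ι κ : Type*} {e : κ → ι} (he : Function.Injective e)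
    (τ : κ → Equiv.Perm ℕ) : IsOpenMap (fun (z : ι → ℕ) (k : κ) => τ k (z (e k))) := by
  classical
  rw [isOpenMap_iff_nhds_le]
  intro z s hs
  rw [Filter.mem_map, nhds_pi, Filter.mem_pi] at hs
  obtain ⟨I, hI, t, ht, hsub⟩ := hs
  rw [nhds_pi, Filter.mem_pi]
  -- By injectivity of `e` the coordinates of the image vary independently, so only those read from
  -- `I` need fixing. Any such `u` lifts to `v`, which keeps the entries of `z` off the range of
  -- `e`.
  refine ⟨e ⁻¹' I, hI.preimage he.injOn, fun k => {τ k (z (e k))}, fun k => by simp, ?_⟩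
  intro u hu
  let v : ι → ℕ := fun i => if h : ∃ k, e k = i then (τ h.choose).symm (u h.choose) else z i
  have key : (fun k => τ k (v (e k))) = u := by
    funext k
    have h : ∃ k', e k' = e k := ⟨k, rfl⟩
    have hk : h.choose = k := he h.choose_spec
    simp only [v, h, dif_pos]
    rw [hk]
    simp
  rw [← key]
  refine mem_preimage.1 (hsub (a := v) fun i hi => ?_)
  by_cases h : ∃ k, e k = i
  · have h1 := h.choose_spec
    have h2 := hu h.choose (by rw [mem_preimage, h1]; exact hi)
    simp only [mem_singleton_iff] at h2
    simp only [v, h, dif_pos, h2, Equiv.symm_apply_apply, h1]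
    exact mem_of_mem_nhds (ht i)
  · simp only [v, h, dif_neg, not_false_eq_true]
    exact mem_of_mem_nhds (ht i)

theorem continuous_reindex {ι κ : Type*} (e : κ → ι) (τ : κ → Equiv.Perm ℕ) :
    Continuous (fun (z : ι → ℕ) (k : κ) => τ k (z (e k))) :=
  continuous_pi fun k => (continuous_of_discreteTopology (f := τ k)).comp (continuous_apply (e k))

theorem tendsto_residual_reindex {ι κ : Type*} {e : κ → ι} (he : Function.Injective e)
    (τ : κ → Equiv.Perm ℕ) :
    Tendsto (fun (z : ι → ℕ) (k : κ) => τ k (z (e k))) (residual _) (residual _) :=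
  tendsto_residual_of_isOpenMap (continuous_reindex e τ) (isOpenMap_reindex he τ)

/-- The arrays which agree with `g` on the first `M` rows and columns of every block. -/
def cyl {α : Type*} (M : ℕ) (g : α × ℕ × ℕ → ℕ) : Set (α × ℕ × ℕ → ℕ) :=
  {z | ∀ a m n, m < M → n < M → z (a, m, n) = g (a, m, n)}

theorem mem_cyl_self {α : Type*} (M : ℕ) (g : α × ℕ × ℕ → ℕ) : g ∈ cyl M g :=
  fun _ _ _ _ _ => rfl

theorem cyl_subset {α : Type*} {M N : ℕ} {g h : α × ℕ × ℕ → ℕ} (hMN : M ≤ N) (hg : h ∈ cyl M g) :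
    cyl N h ⊆ cyl M g := fun z hz a m n hm hn =>
  (hz a m n (by omega) (by omega)).trans (hg a m n hm hn)

theorem isOpen_cyl {α : Type*} [Finite α] (M : ℕ) (g : α × ℕ × ℕ → ℕ) : IsOpen (cyl M g) := by
  have : cyl M g = Set.pi (univ ×ˢ Iio M ×ˢ Iio M) fun i => {g i} := by
    ext z
    simp [cyl, Set.mem_pi]
  rw [this]
  exact isOpen_set_pi (Set.finite_univ.prod ((finite_Iio M).prod (finite_Iio M)))
    fun i _ => isOpen_discrete _

theorem exists_cyl_subset {α : Type*} {U : Set (α × ℕ × ℕ → ℕ)} (hU : IsOpen U)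
    {g : α × ℕ × ℕ → ℕ} (hg : g ∈ U) (N : ℕ) : ∃ M, N ≤ M ∧ cyl M g ⊆ U := by
  obtain ⟨I, hI, t, ht, hsub⟩ := Filter.mem_pi.1 (nhds_pi (a := g) ▸ hU.mem_nhds hg)
  obtain ⟨B, hB⟩ := (hI.image fun i => i.2.1 + i.2.2).bddAbove
  refine ⟨N + B + 1, by omega, fun z hz => hsub fun i hi => ?_⟩
  have h := hB (mem_image_of_mem _ hi)
  obtain ⟨a, m, n⟩ := i
  simp only at h
  rw [hz a m n (by omega) (by omega)]
  exact mem_of_mem_nhds (ht _)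

/-- A dense open condition, with density tested on cylinders, holds generically. -/
theorem eventually_residual_of_cyl {α : Type*} {A : Set (α × ℕ × ℕ → ℕ)} (hA : IsOpen A)
    (h : ∀ M g, ∃ z ∈ cyl M g, z ∈ A) : ∀ᶠ z in residual (α × ℕ × ℕ → ℕ), z ∈ A := by
  refine residual_of_dense_open hA (dense_iff_inter_open.2 fun U hU ⟨g, hg⟩ => ?_)
  obtain ⟨M, -, hM⟩ := exists_cyl_subset hU hg 0
  obtain ⟨z, hz, hzA⟩ := h M g
  exact ⟨z, hM hz, hzA⟩

/-- If countably many Borel sets cover a cylinder generically, then one of them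
generically contains a smaller cylinder. -/
theorem exists_cyl_forces {α κ : Type*} [Finite α] [Countable κ]
    {A : κ → Set (α × ℕ × ℕ → ℕ)} (hA : ∀ k, MeasurableSet (A k)) {M : ℕ} {g : α × ℕ × ℕ → ℕ}
    (h : ∀ᶠ z in residual _, z ∈ cyl M g → ∃ k, z ∈ A k) :
    ∃ k N h, M ≤ N ∧ h ∈ cyl M g ∧ ∀ᶠ z in residual _, z ∈ cyl N h → z ∈ A k := by
  -- Borel sets have the Baire property, so each `A k` may be replaced by an open set up to a meagre
  -- set.
  choose u hu hAu using fun k => (hA k).residualEq_isOpen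
  have h1 : ∀ᶠ z in residual (α × ℕ × ℕ → ℕ), ∀ k, A k z = u k z := eventually_countable_forall.2 hAu
  obtain ⟨z, hz, hz1, hz2⟩ := (dense_of_mem_residual (h.and h1)).inter_open_nonempty _
    (isOpen_cyl M g) ⟨g, mem_cyl_self M g⟩
  obtain ⟨k, hk⟩ := hz1 hz
  have hku : z ∈ u k := (hz2 k).mp hk
  obtain ⟨N, hN, hNu⟩ := exists_cyl_subset (hu k) hku M
  exact ⟨k, N, z, hN, hz, (hAu k).mono fun y hy hyN => hy.mpr (hNu hyN)⟩

/-- A Borel set which is not generic misses a whole cylinder generically. -/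
theorem exists_cyl_of_not_eventually {α : Type*} [Finite α] {A : Set (α × ℕ × ℕ → ℕ)}
    (hA : MeasurableSet A) (h : ¬ ∀ᶠ z in residual _, z ∈ A) :
    ∃ M g, ∀ᶠ z in residual _, z ∈ cyl M g → z ∉ A := by
  obtain ⟨u, hu, hAu⟩ := hA.compl.residualEq_isOpen
  rcases u.eq_empty_or_nonempty with rfl | ⟨g, hg⟩
  · refine absurd (hAu.mono fun z hz => ?_) h
    by_contra hzA
    exact (hz.mp hzA : z ∈ (∅ : Set _))
  · obtain ⟨M, -, hM⟩ := exists_cyl_subset hu hg 0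
    exact ⟨M, g, hAu.mono fun z hz hzM => hz.mpr (hM hzM)⟩

/-! ### Blocks of an array and relabelling of rows and columns -/

/-- The block of an array with label `a`. -/
def block {α : Type*} (z : α × ℕ × ℕ → ℕ) (a : α) : ℕ → ℕ → ℕ := fun m n => z (a, m, n)

/-- Assemble an array from its blocks. -/
def ofBlocks {α : Type*} (v : α → ℕ → ℕ → ℕ) : α × ℕ × ℕ → ℕ := fun i => v i.1 i.2.1 i.2.2

theorem measurable_block {α : Type*} (a : α) :
    Measurable fun z : α × ℕ × ℕ → ℕ => block z a :=
  measurable_pi_lambda _ fun _ => measurable_pi_lambda _ fun _ => measurable_pi_apply _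

theorem measurable_apply_index {Z β : Type*} [MeasurableSpace Z] [MeasurableSpace β]
    {F : Z → ℕ → β} (hF : ∀ i, Measurable fun z => F z i) {a : Z → ℕ} (ha : Measurable a) :
    Measurable fun z => F z (a z) :=
  (measurable_from_prod_countable_left (f := fun p : Z × ℕ => F p.1 p.2) hF).comp
    (measurable_id.prodMk ha)

/-- `f` evaluated after reindexing the columns along `w 0` and the rows along `w 1`. -/
def relabel {β : Type*} (f : (ℕ → ℕ → ℕ) → (ℕ → ℕ → ℕ) → β) (x y w : ℕ → ℕ → ℕ) : β :=
  f (fun m => x (w 0 m)) (fun n m => y (w 1 n) (w 0 m))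

theorem measurable_relabel {Z β : Type*} [MeasurableSpace Z] [MeasurableSpace β]
    {f : (ℕ → ℕ → ℕ) → (ℕ → ℕ → ℕ) → β} (hf : Measurable (Function.uncurry f))
    {x y w : Z → ℕ → ℕ → ℕ} (hx : Measurable x) (hy : Measurable y) (hw : Measurable w) :
    Measurable fun z => relabel f (x z) (y z) (w z) := by
  have hw' : ∀ r m, Measurable fun z => w z r m := fun r m =>
    (measurable_pi_apply m).comp ((measurable_pi_apply r).comp hw)
  refine hf.comp (Measurable.prodMk ?_ ?_)
  · exact measurable_pi_lambda _ fun m => measurable_apply_index (F := fun z => x z)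
      (fun i => (measurable_pi_apply i).comp hx) (hw' 0 m)
  · refine measurable_pi_lambda _ fun n => measurable_pi_lambda _ fun m => ?_
    refine measurable_apply_index (F := fun z i => y z (w z 1 n) i) (fun i => ?_) (hw' 0 m)
    exact measurable_apply_index (F := fun z j => y z j i)
      (fun j => (measurable_pi_apply i).comp ((measurable_pi_apply j).comp hy)) (hw' 1 n)

theorem relabel_perm {β : Type*} (f : (ℕ → ℕ → ℕ) → (ℕ → ℕ → ℕ) → β) (x y w w' : ℕ → ℕ → ℕ)
    (σ τ : Equiv.Perm ℕ) (h0 : ∀ m, w' 0 m = σ.symm (w 0 m)) (h1 : ∀ m, w' 1 m = τ.symm (w 1 m)) :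
    relabel f (fun m => x (σ m)) (fun n m => y (τ n) (σ m)) w' = relabel f x y w := by
  simp [relabel, h0, h1]

/-- Both reindexing maps coded by `w` are onto. -/
def Onto (w : ℕ → ℕ → ℕ) : Prop := Function.Surjective (w 0) ∧ Function.Surjective (w 1)

theorem eventually_exists_apply {α : Type*} (a : α) (r : ℕ) (p : ℕ → Prop)
    (hp : ∃ v, p v) : ∀ᶠ z in residual (α × ℕ × ℕ → ℕ), ∃ m, p (z (a, r, m)) := by
  classical
  refine eventually_residual_of_cyl (A := {z | ∃ m, p (z (a, r, m))}) ?_ ?_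
  · rw [ofPred_exists]
    exact isOpen_iUnion fun m => (isOpen_discrete {v | p v}).preimage (continuous_apply _)
  · obtain ⟨v, hv⟩ := hp
    intro M g
    refine ⟨fun i => if i.2.2 < M then g i else v, fun a m n _ hn => by simp [hn], M, by simpa⟩

theorem eventually_onto {α : Type*} (a : α) :
    ∀ᶠ z in residual (α × ℕ × ℕ → ℕ), Onto (block z a) := by
  have h : ∀ r, ∀ᶠ z in residual (α × ℕ × ℕ → ℕ), ∀ v, ∃ m, z (a, r, m) = v := fun r =>
    eventually_countable_forall.2 fun v => eventually_exists_apply a r (· = v) ⟨v, rfl⟩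
  filter_upwards [h 0, h 1] with z h0 h1
  exact ⟨h0, h1⟩

/-- The involution of `ℕ` exchanging the intervals `[A, B)` and `[B, 2B - A)`. -/
def blockSwap (A B : ℕ) : Equiv.Perm ℕ :=
  Function.Involutive.toPerm
    (fun m => if m < A then m else if m < B then m + (B - A) else
      if m < 2 * B - A then m - (B - A) else m)
    (fun m => by dsimp only; split_ifs <;> omega)

theorem blockSwap_apply (A B m : ℕ) : blockSwap A B m = if m < A then m else
    if m < B then m + (B - A) else if m < 2 * B - A then m - (B - A) else m := rfl

/-- Generic restriction of an array to some of its blocks. -/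
theorem tendsto_residual_blocks {α β : Type*} {e : β → α} (he : Function.Injective e) :
    Tendsto (fun (z : α × ℕ × ℕ → ℕ) (i : β × ℕ × ℕ) => z (e i.1, i.2.1, i.2.2))
      (residual _) (residual _) :=
  tendsto_residual_reindex (e := fun i : β × ℕ × ℕ => (e i.1, i.2.1, i.2.2))
    (by rintro ⟨a, m, n⟩ ⟨b, k, l⟩ h
        simp only [Prod.mk.injEq] at h
        simp [he h.1, h.2.1, h.2.2]) (fun _ => 1)

/-- Below any condition on the third block there is one whose values there are bounded by
its size. -/
theorem exists_bounded_condition (M : ℕ) (g : Fin 3 × ℕ × ℕ → ℕ) :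
    ∃ N a, M ≤ N ∧ a ∈ cyl M g ∧ ∀ r m, a (2, r, m) < N := by
  obtain ⟨B, hB⟩ := (((finite_Iio M).prod (finite_Iio M)).image
    fun i : ℕ × ℕ => g (2, i.1, i.2)).bddAbove
  have hB' : ∀ r n, r < M → n < M → g (2, r, n) ≤ B := fun r n hr hn =>
    hB ⟨(r, n), ⟨hr, hn⟩, rfl⟩
  refine ⟨M + B + 1, fun i => if i.2.1 < M ∧ i.2.2 < M then g i else 0, by omega,
    fun a m n hm hn => by simp [hm, hn], fun r m => ?_⟩
  dsimp only
  split_ifs with h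
  · have := hB' _ _ h.1 h.2
    omega
  · omega

/-! ### Amalgamation of a condition with a permuted copy of itself -/

section amalgamation

variable (N L : ℕ) (c : Fin 4 × ℕ × ℕ → ℕ)

/-- The permutation moving the rows when two conditions are amalgamated. -/
def rowPerm : Equiv.Perm ℕ := (blockSwap 0 N).trans (blockSwap N L)

theorem rowPerm_apply (m : ℕ) : rowPerm N L m = blockSwap N L (blockSwap 0 N m) := rfl

/-- The map from six blocks to four blocks that applies the column and row permutations. -/
def twist (z : Fin 6 × ℕ × ℕ → ℕ) : Fin 4 × ℕ × ℕ → ℕ :=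
  ofBlocks ![fun m n => block z 0 (blockSwap N L m) n, block z 4,
    fun n m => block z 1 (rowPerm N L n) (blockSwap N L m),
    fun r m => if r = 0 then (blockSwap N L).symm (block z 5 r m)
      else (rowPerm N L).symm (block z 5 r m)]

/-- This form, an injective choice of coordinates followed by permutations of values, is what makes
`twist` continuous and genericity-preserving. -/
theorem twist_eq_reindex : twist N L = fun (z : Fin 6 × ℕ × ℕ → ℕ) i =>
    (![fun _ => 1, fun _ => 1, fun _ => 1,
      fun r => if r = 0 then (blockSwap N L).symm else (rowPerm N L).symm] i.1 i.2.1 :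
        Equiv.Perm ℕ)
    (z ((![fun m n => (0, blockSwap N L m, n), fun m n => (4, m, n),
      fun n m => (1, rowPerm N L n, blockSwap N L m), fun m n => (5, m, n)] :
        Fin 4 → ℕ → ℕ → Fin 6 × ℕ × ℕ) i.1 i.2.1 i.2.2)) := by
  funext z ⟨a, m, n⟩
  fin_cases a
  · rfl
  · rfl
  · rfl
  · simp only [twist, ofBlocks, block]
    by_cases h : m = 0 <;> simp [h]

theorem continuous_twist : Continuous (twist N L) := by
  rw [twist_eq_reindex]
  exact continuous_reindex _ _

theorem tendsto_residual_twist : Tendsto (twist N L) (residual _) (residual _) := by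
  rw [twist_eq_reindex]
  refine tendsto_residual_reindex ?_ _
  rintro ⟨a, m, n⟩ ⟨b, k, l⟩ h
  fin_cases a <;> fin_cases b <;> simp_all

/-- The array in which a condition `c` and its twisted copy are amalgamated. -/
def amalgam : Fin 6 × ℕ × ℕ → ℕ :=
  ofBlocks ![fun m n => if m < L then c (0, m, n) else c (0, blockSwap N L m, n),
    fun n m => if n < L ∧ m < L then c (1, n, m)
      else c (2, (rowPerm N L).symm n, blockSwap N L m),
    block c 2, block c 3, block c 1,
    fun r m => if r = 0 then blockSwap N L (c (3, r, m)) else rowPerm N L (c (3, r, m))]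

theorem blockSwap_blockSwap (m : ℕ) : blockSwap N L (blockSwap N L m) = m :=
  (blockSwap N L).symm_apply_apply m

variable {N L c}

/-- The column permutation fixes indices below `N` and sends `[N, L)` to indices at least `L`. The
row permutation sends `[N, 2N)` to `[0, N)` and every other row below `L` to a row at least `L`. So
`c` and its copy meet in the columns of `x` below `N`, where they agree trivially, and in an `N × N`
corner of `y`, where `h2` makes them agree. The remaining blocks 4 and 5 are fresh. -/
theorem twist_amalgam (hL : 2 * N ≤ L)
    (h2 : ∀ n m, n < N → m < N → c (2, n + N, m) = c (1, n, m)) :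
    twist N L (amalgam N L c) ∈ cyl L c := by
  intro a m n hm hn
  fin_cases a
  · simp only [twist, amalgam, ofBlocks, block, Fin.zero_eta, Matrix.cons_val_zero,
      blockSwap_blockSwap]
    split_ifs with h
    · have : blockSwap N L m = m := by
        rw [blockSwap_apply] at h ⊢
        split_ifs at h ⊢ <;> omega
      rw [this]
    · rfl
  · rfl
  · simp only [twist, amalgam, ofBlocks, block, Fin.reduceFinMk, Matrix.cons_val,
      blockSwap_blockSwap, Equiv.symm_apply_apply]
    split_ifs with h
    -- This is the overlapping corner: the row lies in `[N, 2N)` and the column below `N`.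
    · obtain ⟨h, h'⟩ := h
      have hn' : n < N ∧ blockSwap N L n = n := by
        rw [blockSwap_apply] at h' ⊢
        split_ifs at h' ⊢ <;> omega
      have hm' : N ≤ m ∧ m < N + N ∧ rowPerm N L m = m - N := by
        rw [rowPerm_apply, blockSwap_apply, blockSwap_apply] at h ⊢
        split_ifs at h ⊢ <;> omega
      rw [hm'.2.2, hn'.2, ← h2 _ _ (by omega) hn'.1, Nat.sub_add_cancel hm'.1]
    · rfl
  · simp only [twist, amalgam, ofBlocks, block, Fin.reduceFinMk, Matrix.cons_val]
    split_ifs <;> simp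

end amalgamation

/-! ### Independence of an invariant countable set from the second generic array -/

/-- Generically, the set of values of an invariant function does not depend on the second argument. -/
theorem eventually_range_subset {f : (ℕ → ℕ → ℕ) → (ℕ → ℕ → ℕ) → ℕ → ℝ}
    (hf : Measurable (Function.uncurry f))
    (hinv : ∀ x y w, Onto w → range (relabel f x y w) = range (f x y)) :
    ∀ᶠ z in residual (Fin 3 × ℕ × ℕ → ℕ),
      range (f (block z 0) (block z 1)) ⊆ range (f (block z 0) (block z 2)) := by
  have hmf : ∀ {r : ℕ} (a b : Fin r) (k : ℕ),
      Measurable fun z : Fin r × ℕ × ℕ → ℕ => f (block z a) (block z b) k := fun a b k =>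
    (measurable_pi_apply k).comp
      (hf.comp ((measurable_block a).prodMk (measurable_block b)))
  have hmr : ∀ {r : ℕ} (a b d : Fin r) (k : ℕ), Measurable fun z : Fin r × ℕ × ℕ → ℕ =>
      relabel f (block z a) (block z b) (block z d) k := fun a b d k =>
    (measurable_pi_apply k).comp
      (measurable_relabel hf (measurable_block a) (measurable_block b) (measurable_block d))
  simp only [range_subset_iff]
  refine eventually_countable_forall.2 fun k => ?_
  by_contra hcon
  obtain ⟨M, g, hg⟩ := exists_cyl_of_not_eventually
    (A := {z | f (block z 0) (block z 1) k ∈ range (f (block z 0) (block z 2))})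
    (by
      simp only [mem_range, ofPred_exists]
      exact MeasurableSet.iUnion fun j => measurableSet_eq_fun (hmf 0 2 j) (hmf 0 1 k)) hcon
  -- the value is also the value of a relabelled array at a fixed place
  obtain ⟨k₂, N₀, a₀, hMN₀, ha₀, hforce₀⟩ := exists_cyl_forces (M := M)
    -- Block 2 now holds the relabelling `w` instead of the second argument `y'`; its starting value
    -- `0` is arbitrary.
    (g := (ofBlocks ![block g 0, block g 1, 0] : Fin 3 × ℕ × ℕ → ℕ))
    (A := fun j => {z | f (block z 0) (block z 1) k =
      relabel f (block z 0) (block z 1) (block z 2) j})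
    (fun j => measurableSet_eq_fun (hmf 0 1 k) (hmr 0 1 2 j)) (by
      filter_upwards [eventually_onto (2 : Fin 3)] with z hz _
      have : f (block z 0) (block z 1) k ∈ range (f (block z 0) (block z 1)) := ⟨k, rfl⟩
      rw [← hinv _ _ _ hz] at this
      obtain ⟨j, hj⟩ := this
      exact ⟨j, hj.symm⟩)
  obtain ⟨N, a, hN₀N, ha, hbd⟩ := exists_bounded_condition N₀ a₀
  have hforce : ∀ᶠ z in residual _, z ∈ cyl N a → f (block z 0) (block z 1) k =
      relabel f (block z 0) (block z 1) (block z 2) k₂ :=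
    hforce₀.mono fun z hz hzN => hz (cyl_subset hN₀N ha hzN)
  have hag : ∀ i m n, m < M → n < M → i ≠ 2 → a (i, m, n) = g (i, m, n) := by
    intro i m n hm hn hi
    rw [ha i m n (by omega) (by omega), ha₀ i m n hm hn]
    fin_cases i
    · rfl
    · rfl
    · exact absurd rfl hi
  clear hforce₀ ha₀ ha
  -- the values for two second arguments are separated by a rational number
  let b : Fin 4 × ℕ × ℕ → ℕ := ofBlocks ![block a 0, block a 1,
    fun n m => if n < N then g (2, n, m) else a (1, n - N, m),
    fun r m => if r = 0 then a (2, 0, m) else a (2, r, m) + N]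
  -- By invariance the right-hand value belongs to the set for `(x, y')`, from which `g` excludes
  -- the left-hand value.
  have hsep : ∀ᶠ z in residual _, z ∈ cyl (2 * N) b →
      f (block z 0) (block z 1) k ≠ relabel f (block z 0) (block z 2) (block z 3) k₂ := by
    have hinj : Function.Injective (![0, 1, 2] : Fin 3 → Fin 4) := by decide
    filter_upwards [eventually_onto (3 : Fin 4), (tendsto_residual_blocks hinj).eventually hg]
      with z hz hzg hzb heq
    refine hzg ?_ ?_
    · intro i m n hm hn
      fin_cases i
      · exact (hzb 0 m n (by omega) (by omega)).trans (hag 0 m n hm hn (by decide))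
      · exact (hzb 1 m n (by omega) (by omega)).trans (hag 1 m n hm hn (by decide))
      · exact (hzb 2 m n (by omega) (by omega)).trans (if_pos (show m < N by omega))
    · show f (block z 0) (block z 1) k ∈ range (f (block z 0) (block z 2))
      rw [← hinv _ _ _ hz, heq]
      exact mem_range_self _
  -- The Boolean records which of the two values is the smaller, so that `c` decides the order as
  -- well as the rational.
  obtain ⟨q, L, c, hL, hc, hfc⟩ := exists_cyl_forces (κ := ℚ × Bool) (M := 2 * N) (g := b)
    (A := fun q => {z |
      (q.2 = true → f (block z 0) (block z 1) k < q.1 ∧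
        (q.1 : ℝ) < relabel f (block z 0) (block z 2) (block z 3) k₂) ∧
      (q.2 = false → relabel f (block z 0) (block z 2) (block z 3) k₂ < q.1 ∧
        (q.1 : ℝ) < f (block z 0) (block z 1) k)})
    (by
      rintro ⟨q, _ | _⟩
      · simp only [reduceCtorEq, false_imp_iff, true_and, true_imp_iff]
        exact (measurableSet_lt (hmr 0 2 3 k₂) measurable_const).inter
          (measurableSet_lt measurable_const (hmf 0 1 k))
      · simp only [reduceCtorEq, false_imp_iff, and_true, true_imp_iff]
        exact (measurableSet_lt (hmf 0 1 k) measurable_const).inter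
          (measurableSet_lt measurable_const (hmr 0 2 3 k₂)))
    (by
      filter_upwards [hsep] with z hz hzb
      rcases lt_or_gt_of_ne (hz hzb) with h | h
      · obtain ⟨q, hq⟩ := exists_rat_btwn h
        exact ⟨(q, true), by simpa using hq⟩
      · obtain ⟨q, hq⟩ := exists_rat_btwn h
        exact ⟨(q, false), by simpa using hq⟩)
  -- amalgamate the condition with its twisted copy
  let p₁ : (Fin 6 × ℕ × ℕ → ℕ) → Fin 4 × ℕ × ℕ → ℕ :=
    fun z i => z ((![0, 1, 2, 3] : Fin 4 → Fin 6) i.1, i.2.1, i.2.2)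
  let p₃ : (Fin 6 × ℕ × ℕ → ℕ) → Fin 3 × ℕ × ℕ → ℕ :=
    fun z i => z ((![0, 1, 5] : Fin 3 → Fin 6) i.1, i.2.1, i.2.2)
  have hp₁ : Tendsto p₁ (residual _) (residual _) := tendsto_residual_blocks (by decide)
  have hp₃ : Tendsto p₃ (residual _) (residual _) := tendsto_residual_blocks (by decide)
  have hcp₁ : Continuous p₁ := continuous_pi fun i => continuous_apply _
  have hcp₃ : Continuous p₃ := continuous_pi fun i => continuous_apply _
  have hc2 : ∀ n m, n < N → m < N → c (2, n + N, m) = c (1, n, m) := by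
    intro n m hn hm
    rw [hc 2 _ _ (by omega) (by omega), hc 1 _ _ (by omega) (by omega)]
    simp [b, ofBlocks, block]
  have hd₁ : amalgam N L c ∈ p₁ ⁻¹' cyl L c := by
    intro i m n hm hn
    fin_cases i <;> simp [p₁, amalgam, ofBlocks, block, hm, hn]
  -- Since the values of `a` in `w` are below `N`, the column permutation fixes them and the row
  -- permutation undoes the shift by `N` made in `b`.
  have hd₃ : amalgam N L c ∈ p₃ ⁻¹' cyl N a := by
    intro i m n hm hn
    fin_cases i
    · refine Eq.trans ?_ (hc 0 m n (by omega) (by omega))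
      exact if_pos (show m < L by omega)
    · refine Eq.trans ?_ (hc 1 m n (by omega) (by omega))
      exact if_pos (show m < L ∧ n < L by omega)
    · have hv := hbd m n
      have hcb := hc 3 m n (by omega) (by omega)
      by_cases hm0 : m = 0
      · subst hm0
        simp only [b, ofBlocks, Matrix.cons_val, if_true] at hcb
        simp only [p₃, amalgam, ofBlocks, Fin.reduceFinMk, Matrix.cons_val, if_true, hcb,
          blockSwap_apply, hv]
      · simp only [b, ofBlocks, Matrix.cons_val, hm0, if_false] at hcb
        simp only [p₃, amalgam, ofBlocks, Fin.reduceFinMk, Matrix.cons_val, hm0, if_false, hcb,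
          rowPerm_apply, blockSwap_apply]
        split_ifs <;> omega
  -- The three open conditions share the point `amalgam N L c`, so their intersection contains a
  -- generic `z` obeying all three forced statements.
  obtain ⟨z, hz, hz₁, hz₂, hz₃⟩ := (dense_of_mem_residual ((hp₁.eventually hfc).and
    (((tendsto_residual_twist N L).eventually hfc).and (hp₃.eventually hforce)))).inter_open_nonempty
    _ (((isOpen_cyl L c).preimage hcp₁).inter (((isOpen_cyl L c).preimage
      (continuous_twist N L)).inter ((isOpen_cyl N a).preimage hcp₃)))
    ⟨_, hd₁, twist_amalgam hL hc2, hd₃⟩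
  have h₁ := hz₁ hz.1
  have h₂ := hz₂ hz.2.1
  have h₃ : f (block z 0) (block z 1) k = relabel f (block z 0) (block z 1) (block z 5) k₂ :=
    hz₃ hz.2.2
  -- The permutations of the arrays cancel against their inverses in `w`. What remains is the
  -- relabelling of `(x, y)` by block 5, which `a` forces to give the `k`-th value.
  have e₂ : relabel f (block (twist N L z) 0) (block (twist N L z) 2) (block (twist N L z) 3) k₂
      = f (block z 0) (block z 1) k := by
    rw [h₃, ← relabel_perm f _ _ _ (block (twist N L z) 3) (blockSwap N L) (rowPerm N L)
      (fun _ => rfl) (fun _ => rfl)]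
    rfl
  have e₁ : f (block (p₁ z) 0) (block (p₁ z) 1) k = f (block z 0) (block z 1) k := rfl
  simp only [mem_ofPred_eq, e₁, e₂] at h₁ h₂
  -- The same real is the left-hand value for `c` and the right-hand value for the twisted copy,
  -- hence lies on both sides of `q`.
  obtain ⟨q, _ | _⟩ := q
  · exact lt_asymm (h₁.2 rfl).2 (h₂.2 rfl).1
  · exact lt_asymm (h₁.1 rfl).1 (h₂.1 rfl).2

/-! ### Jumps of equality as equality of ranges -/

theorem jump_eqRel_iff {X : Type*} {u v : ℕ → X} : jump (eqRel X) u v ↔ range u = range v := by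
  refine ⟨fun h => Subset.antisymm ?_ ?_, fun h => ⟨fun n => ?_, fun n => ?_⟩⟩
  · rintro _ ⟨n, rfl⟩
    obtain ⟨m, hm⟩ := h.1 n
    exact ⟨m, hm.symm⟩
  · rintro _ ⟨n, rfl⟩
    obtain ⟨m, hm⟩ := h.2 n
    exact ⟨m, hm.symm⟩
  · obtain ⟨m, hm⟩ := h ▸ mem_range_self (f := u) n
    exact ⟨m, hm.symm⟩
  · obtain ⟨m, hm⟩ := h ▸ mem_range_self (f := v) n
    exact ⟨m, hm.symm⟩

theorem jump_jump_eqRel_iff {X : Type*} {u v : ℕ → ℕ → X} :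
    jump (jump (eqRel X)) u v ↔ range (fun n => range (u n)) = range fun n => range (v n) := by
  rw [← jump_eqRel_iff]
  exact and_congr (forall_congr' fun n => exists_congr fun m => jump_eqRel_iff)
    (forall_congr' fun n => exists_congr fun m => jump_eqRel_iff)

/-! ### The double jump of equality is not reducible to the jump -/

/-- The sequence of sequences of reals whose `n`th term lists the graph of `x m ↦ y n m`. -/
noncomputable def graphs (x y : ℕ → ℕ → ℕ) : ℕ → ℕ → ℝ :=
  fun n m => MeasureTheory.embeddingReal ((ℕ → ℕ) × ℕ) (x m, y n m)

theorem graphs_inj {x y x' y' : ℕ → ℕ → ℕ} {n m n' m' : ℕ}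
    (h : graphs x y n m = graphs x' y' n' m') : x m = x' m' ∧ y n m = y' n' m' := by
  simpa using (MeasureTheory.measurableEmbedding_embeddingReal ((ℕ → ℕ) × ℕ)).injective h

theorem measurable_graphs : Measurable (Function.uncurry graphs) := by
  refine measurable_pi_lambda _ fun n => measurable_pi_lambda _ fun m => ?_
  refine (MeasureTheory.measurableEmbedding_embeddingReal ((ℕ → ℕ) × ℕ)).measurable.comp
    (Measurable.prodMk ?_ ?_)
  · exact (measurable_pi_apply m).comp measurable_fst
  · exact (measurable_pi_apply m).comp ((measurable_pi_apply n).comp measurable_snd)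

theorem jump_jump_graphs_relabel (x y w : ℕ → ℕ → ℕ) (hw : Onto w) :
    jump (jump (eqRel ℝ)) (relabel graphs x y w) (graphs x y) := by
  rw [jump_jump_eqRel_iff]
  have h : ∀ n, range (relabel graphs x y w n) = range (graphs x y (w 1 n)) := fun n =>
    hw.1.range_comp (graphs x y (w 1 n))
  simp only [h]
  exact hw.2.range_comp fun n => range (graphs x y n)

theorem eventually_rows_ne {α : Type*} {a b : α} {r s : ℕ} (h : (a, r) ≠ (b, s)) :
    ∀ᶠ z in residual (α × ℕ × ℕ → ℕ), block z a r ≠ block z b s := by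
  classical
  have : ∀ᶠ z in residual (α × ℕ × ℕ → ℕ), z ∈ {z | ∃ n, z (a, r, n) ≠ z (b, s, n)} := by
    refine eventually_residual_of_cyl ?_ fun M g => ?_
    · rw [ofPred_exists]
      exact isOpen_iUnion fun n =>
        isOpen_ne_fun (continuous_apply (a, r, n)) (continuous_apply (b, s, n))
    · refine ⟨fun i => if i.2.2 < M then g i else if (i.1, i.2.1) = (a, r) then 1 else 0,
        fun a m n _ hn => by simp [hn], M, ?_⟩
      simp [h.symm]
  exact this.mono fun z ⟨n, hn⟩ heq => hn (congrFun heq n)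

/-- A reduction would identify the families for `(x, y)` and `(x, y')`. Generically `x` is
injective, so equal graphs have equal rows, yet row 0 of `y'` differs from every row of `y`. -/
theorem not_jump_jump_reducible_jump :
    ¬ BorelReducible (jump (jump (eqRel ℝ))) (jump (eqRel ℝ)) := by
  rintro ⟨f, hf, hred⟩
  have hev := eventually_range_subset (f := fun x y => f (graphs x y))
    (hf.comp measurable_graphs)
    (fun x y w hw => jump_eqRel_iff.1 ((hred _ _).1 (jump_jump_graphs_relabel x y w hw)))
  -- Exchanging `y` and `y'` yields the reverse inclusion.
  have hinj : Function.Injective (![0, 2, 1] : Fin 3 → Fin 3) := by decide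
  have hrows : ∀ᶠ z in residual (Fin 3 × ℕ × ℕ → ℕ), ∀ m m', m ≠ m' →
      block z 0 m ≠ block z 0 m' := by
    refine eventually_countable_forall.2 fun m => eventually_countable_forall.2 fun m' => ?_
    by_cases h : m = m'
    · simp [h]
    · filter_upwards [eventually_rows_ne (a := (0 : Fin 3)) (b := 0) (r := m) (s := m') (by simpa)]
        with z hz _ using hz
  have hnew : ∀ᶠ z in residual (Fin 3 × ℕ × ℕ → ℕ), ∀ n, block z 2 0 ≠ block z 1 n :=
    eventually_countable_forall.2 fun n => eventually_rows_ne (by simp)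
  obtain ⟨z, h1, h2, h3, h4⟩ := (dense_of_mem_residual (hev.and
    (((tendsto_residual_blocks hinj).eventually hev).and (hrows.and hnew)))).nonempty
  have hE : jump (jump (eqRel ℝ)) (graphs (block z 0) (block z 1))
      (graphs (block z 0) (block z 2)) :=
    (hred _ _).2 (jump_eqRel_iff.2 (Subset.antisymm h1 h2))
  obtain ⟨n, hn⟩ := hE.2 0
  refine h4 n (funext fun m => ?_)
  obtain ⟨m', hm'⟩ := hn.1 m
  obtain ⟨hx, hy⟩ := graphs_inj hm'
  by_cases hmm : m = m'
  · rw [hy, hmm]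
  · exact absurd hx (h3 m m' hmm)

/-! ### The set `P` and the relations `E`, `F`, `G` -/

theorem BorelReducible.trans {X Y Z : Type*} [MeasurableSpace X] [MeasurableSpace Y]
    [MeasurableSpace Z] {R : Setoid X} {S : Setoid Y} {T : Setoid Z}
    (h : BorelReducible R S) (k : BorelReducible S T) : BorelReducible R T := by
  obtain ⟨f, hf, hfr⟩ := h
  obtain ⟨g, hg, hgr⟩ := k
  exact ⟨g ∘ f, hg.comp hf, fun x y => (hfr x y).trans (hgr _ _)⟩

theorem eventually_residual_of_isOpen {Z : Type*} [TopologicalSpace Z] {p : Z → Prop}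
    (ho : IsOpen {z | p z}) (hd : Dense {z | p z}) : ∀ᶠ z in residual Z, p z :=
  residual_of_dense_open ho hd

theorem isOpen_snd_apply_eq_true (k m : ℕ) :
    IsOpen {p : (ℕ → ℝ) × (ℕ → ℕ → Bool) | p.2 k m = true} :=
  (isOpen_discrete {true}).preimage (f := fun p : (ℕ → ℝ) × (ℕ → ℕ → Bool) => p.2 k m)
    ((continuous_apply m).comp ((continuous_apply k).comp continuous_snd))

theorem isGδ_setP : IsGδ setP := by
  have h : setP = (⋂ m, ⋃ k, {p | p.2 k m = true}) ∩ ((⋂ k, ⋃ m, {p | p.2 k m = true}) ∩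
      ⋂ k, ⋂ l₁, ⋂ l₂, ({p | p.1 l₁ ≠ p.1 l₂} ∪ {p | p.2 k l₁ = p.2 k l₂})) := by
    ext p
    simp only [setP, mem_ofPred_eq, mem_inter_iff, mem_iInter, mem_iUnion, mem_union,
      imp_iff_not_or, ne_eq]
  rw [h]
  refine (IsGδ.iInter_of_isOpen fun m => isOpen_iUnion fun k => isOpen_snd_apply_eq_true k m).inter
    ((IsGδ.iInter_of_isOpen fun k => isOpen_iUnion fun m => isOpen_snd_apply_eq_true k m).inter
    (.iInter fun k => .iInter fun l₁ => .iInter fun l₂ => (IsOpen.union ?_ ?_).isGδ))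
  · exact isOpen_ne_fun ((continuous_apply l₁).comp continuous_fst)
      ((continuous_apply l₂).comp continuous_fst)
  · exact (isOpen_discrete {b : Bool × Bool | b.1 = b.2}).preimage 
      (f := fun p : (ℕ → ℝ) × (ℕ → ℕ → Bool) => (p.2 k l₁, p.2 k l₂))
      (((continuous_apply l₁).comp ((continuous_apply k).comp continuous_snd)).prodMk
      ((continuous_apply l₂).comp ((continuous_apply k).comp continuous_snd)))

theorem dense_setP : Dense setP := by
  -- Switching on all bits whose row index (or column index, according to `c`) is at least `s`
  -- changes any given coordinate for only finitely many `s`.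
  have hlim : ∀ (p : (ℕ → ℝ) × (ℕ → ℕ → Bool)) (c : ℕ → ℕ → ℕ),
      Tendsto (fun s : ℕ => (p.1, fun k m => if s ≤ c k m then true else p.2 k m))
        atTop (𝓝 p) := by
    intro p c
    refine tendsto_const_nhds.prodMk_nhds (tendsto_pi_nhds.2 fun k => tendsto_pi_nhds.2 fun m => ?_)
    refine tendsto_const_nhds.congr' ?_
    filter_upwards [eventually_gt_atTop (c k m)] with s hs
    rw [if_neg (by omega)]
  have h1 : ∀ᶠ p in residual ((ℕ → ℝ) × (ℕ → ℕ → Bool)), ∀ m, ∃ k, p.2 k m = true := by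
    refine eventually_countable_forall.2 fun m => eventually_residual_of_isOpen ?_ fun p => ?_
    · rw [ofPred_exists]
      exact isOpen_iUnion fun k => isOpen_snd_apply_eq_true k m
    · exact mem_closure_of_tendsto (hlim p fun k _ => k) (.of_forall fun s => ⟨s, by simp⟩)
  have h2 : ∀ᶠ p in residual ((ℕ → ℝ) × (ℕ → ℕ → Bool)), ∀ k, ∃ m, p.2 k m = true := by
    refine eventually_countable_forall.2 fun k => eventually_residual_of_isOpen ?_ fun p => ?_
    · rw [ofPred_exists]
      exact isOpen_iUnion fun m => isOpen_snd_apply_eq_true k m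
    · exact mem_closure_of_tendsto (hlim p fun _ m => m) (.of_forall fun s => ⟨s, by simp⟩)
  -- Injectivity of `x` is generic and makes clause (3) of $P$ automatic.
  have h3 : ∀ᶠ p in residual ((ℕ → ℝ) × (ℕ → ℕ → Bool)), ∀ l₁ l₂, l₁ ≠ l₂ → p.1 l₁ ≠ p.1 l₂ := by
    refine eventually_countable_forall.2 fun l₁ => eventually_countable_forall.2 fun l₂ => ?_
    by_cases hl : l₁ = l₂
    · simp [hl]
    refine (eventually_residual_of_isOpen (p := fun p : (ℕ → ℝ) × (ℕ → ℕ → Bool) => p.1 l₁ ≠ p.1 l₂)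
      (isOpen_ne_fun ((continuous_apply l₁).comp continuous_fst)
        ((continuous_apply l₂).comp continuous_fst)) fun p => ?_).mono fun p hp _ => hp
    by_cases hp : p.1 l₁ = p.1 l₂
    · have ht : Tendsto (fun s : ℕ => p.1 l₁ + 1 / ((s : ℝ) + 1)) atTop (𝓝 (p.1 l₁)) := by
        simpa using tendsto_const_nhds.add (tendsto_one_div_add_atTop_nhds_zero_nat (𝕜 := ℝ))
      have ht' : Tendsto (fun s : ℕ => (Function.update p.1 l₁ (p.1 l₁ + 1 / ((s : ℝ) + 1)), p.2))
          atTop (𝓝 p) := by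
        refine Tendsto.prodMk_nhds ?_ tendsto_const_nhds
        simpa using (tendsto_const_nhds (x := p.1)).update l₁ ht
      refine mem_closure_of_tendsto ht' (.of_forall fun s => ?_)
      have : (0 : ℝ) < 1 / ((s : ℝ) + 1) := by positivity
      simp only [mem_ofPred_eq, Function.update_self, Function.update_of_ne (Ne.symm hl), ← hp]
      linarith
    · exact subset_closure hp
  refine dense_of_mem_residual ?_
  filter_upwards [h1, h2, h3] with p hp1 hp2 hp3
  refine ⟨hp1, hp2, fun k l₁ l₂ h => ?_⟩
  by_cases hl : l₁ = l₂
  · rw [hl]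
  · exact absurd h (hp3 l₁ l₂ hl)

/-! ### Borelness of the relations -/

theorem isBorelEquiv_jump {X : Type*} [MeasurableSpace X] {R : Setoid X} (hR : IsBorelEquiv R) :
    IsBorelEquiv (jump R) := by
  have hm : ∀ n m, Measurable fun p : (ℕ → X) × (ℕ → X) => (p.1 n, p.2 m) := fun n m =>
    ((measurable_pi_apply n).comp measurable_fst).prodMk
      ((measurable_pi_apply m).comp measurable_snd)
  have hm' : ∀ n m, Measurable fun p : (ℕ → X) × (ℕ → X) => (p.2 n, p.1 m) := fun n m =>
    ((measurable_pi_apply n).comp measurable_snd).prodMk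
      ((measurable_pi_apply m).comp measurable_fst)
  have h : {p : (ℕ → X) × (ℕ → X) | jump R p.1 p.2} =
      (⋂ n, ⋃ m, (fun p : (ℕ → X) × (ℕ → X) => (p.1 n, p.2 m)) ⁻¹' {q | R q.1 q.2}) ∩
      ⋂ n, ⋃ m, (fun p : (ℕ → X) × (ℕ → X) => (p.2 n, p.1 m)) ⁻¹' {q | R q.1 q.2} := by
    ext p
    simp only [mem_ofPred_eq, mem_inter_iff, mem_iInter, mem_iUnion, mem_preimage]
    rfl
  rw [IsBorelEquiv, h]
  exact (MeasurableSet.iInter fun n => MeasurableSet.iUnion fun m => hm n m hR).inter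
    (MeasurableSet.iInter fun n => MeasurableSet.iUnion fun m => hm' n m hR)

theorem isBorelEquiv_eqRel (X : Type*) [MeasurableSpace X] [StandardBorelSpace X] :
    IsBorelEquiv (eqRel X) :=
  measurableSet_eq_fun measurable_fst measurable_snd

theorem measurable_mem_carve {Z : Type*} [MeasurableSpace Z]
    {p : Z → (ℕ → ℝ) × (ℕ → ℕ → Bool)} (hp : Measurable p) {r : Z → ℝ} (hr : Measurable r)
    (n : ℕ) : MeasurableSet {z | r z ∈ carve (p z) n} := by
  have h : {z | r z ∈ carve (p z) n} =
      ⋃ m, {z | (p z).2 n m = true} ∩ {z | (p z).1 m = r z} := by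
    ext z
    simp [carve]
  rw [h]
  refine .iUnion fun m => .inter ?_ ?_
  · exact measurableSet_eq_fun ((measurable_pi_apply m).comp
      ((measurable_pi_apply n).comp (measurable_snd.comp hp))) measurable_const
  · exact measurableSet_eq_fun ((measurable_pi_apply m).comp (measurable_fst.comp hp)) hr

theorem measurableSet_carve_subset {Z : Type*} [MeasurableSpace Z]
    {p q : Z → (ℕ → ℝ) × (ℕ → ℕ → Bool)} (hp : Measurable p) (hq : Measurable q) (n k : ℕ) :
    MeasurableSet {z | carve (p z) n ⊆ carve (q z) k} := by
  have h : {z | carve (p z) n ⊆ carve (q z) k} =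
      ⋂ m, {z | (p z).2 n m = true}ᶜ ∪ {z | (p z).1 m ∈ carve (q z) k} := by
    ext z
    simp only [mem_ofPred_eq, mem_iInter, mem_union, mem_compl_iff, ← imp_iff_not_or]
    refine ⟨fun h m hm => h ⟨m, hm, rfl⟩, ?_⟩
    rintro h _ ⟨m, hm, rfl⟩
    exact h m hm
  rw [h]
  refine .iInter fun m => .union (.compl ?_) ?_
  · exact measurableSet_eq_fun ((measurable_pi_apply m).comp
      ((measurable_pi_apply n).comp (measurable_snd.comp hp))) measurable_const
  · exact measurable_mem_carve hq ((measurable_pi_apply m).comp (measurable_fst.comp hp)) k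

theorem relE_iff {p q : setP} : relE p q ↔
    (∀ n, ∃ k, carve p.1 n ⊆ carve q.1 k ∧ carve q.1 k ⊆ carve p.1 n) ∧
    ∀ n, ∃ k, carve q.1 n ⊆ carve p.1 k ∧ carve p.1 k ⊆ carve q.1 n := by
  simp only [← subset_antisymm_iff]
  exact jump_eqRel_iff.symm

theorem isBorelEquiv_relE : IsBorelEquiv relE := by
  have h1 : Measurable fun p : setP × setP => p.1.1 := measurable_subtype_coe.comp measurable_fst
  have h2 : Measurable fun p : setP × setP => p.2.1 := measurable_subtype_coe.comp measurable_snd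
  have h : {p : setP × setP | relE p.1 p.2} =
      (⋂ n, ⋃ k, {p | carve p.1.1 n ⊆ carve p.2.1 k} ∩ {p | carve p.2.1 k ⊆ carve p.1.1 n}) ∩
      ⋂ n, ⋃ k, {p | carve p.2.1 n ⊆ carve p.1.1 k} ∩ {p | carve p.1.1 k ⊆ carve p.2.1 n} := by
    ext p
    simp only [mem_ofPred_eq, relE_iff, mem_inter_iff, mem_iInter, mem_iUnion]
  rw [IsBorelEquiv, h]
  exact .inter
    (.iInter fun n => .iUnion fun k => .inter (measurableSet_carve_subset h1 h2 n k)
      (measurableSet_carve_subset h2 h1 k n))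
    (.iInter fun n => .iUnion fun k => .inter (measurableSet_carve_subset h2 h1 n k)
      (measurableSet_carve_subset h1 h2 k n))

/-! ### Projection to `F` and the reductions -/

theorem iUnion_carve {p : (ℕ → ℝ) × (ℕ → ℕ → Bool)} (hp : p ∈ setP) :
    ⋃₀ range (carve p) = range p.1 := by
  ext r
  simp only [sUnion_range, mem_iUnion, mem_range]
  constructor
  · rintro ⟨n, m, -, h⟩
    exact ⟨m, h⟩
  · rintro ⟨m, h⟩
    obtain ⟨k, hk⟩ := hp.1 m
    exact ⟨k, m, hk, h⟩

theorem relF_of_relE (p q : setP) (h : relE p q) : relF p.1.1 q.1.1 := by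
  have h' : range (carve p.1) = range (carve q.1) := h
  exact jump_eqRel_iff.2 (by rw [← iUnion_carve p.2, ← iUnion_carve q.2, h'])

/-- On the class of `x₀` each carved set lies in the range of `x₀`, so it is determined by the set
of indices `m` with `x₀ m` in it. -/
theorem restrict_relE_reducible (x₀ : ℕ → ℝ) :
    BorelReducible (restrict relE {p : setP | relF p.1.1 x₀}) relG := by
  classical
  refine ⟨fun p n m => decide (x₀ m ∈ carve p.1.1 n), ?_, fun p q => ?_⟩
  · refine measurable_pi_lambda _ fun n => measurable_pi_lambda _ fun m => ?_
    refine measurable_to_bool ?_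
    have h := measurable_mem_carve (p := fun p : {p : setP | relF p.1.1 x₀} => p.1.1)
      (measurable_subtype_coe.comp measurable_subtype_coe) (measurable_const (a := x₀ m)) n
    convert h using 1
    ext p
    simp
  · have key : ∀ (p : {p : setP | relF p.1.1 x₀}) n,
        carve p.1.1 n = x₀ '' {m | decide (x₀ m ∈ carve p.1.1 n) = true} := by
      intro p n
      ext r
      simp only [decide_eq_true_eq, mem_image, mem_ofPred_eq]
      refine ⟨fun hr => ?_, ?_⟩
      · obtain ⟨l, hl, rfl⟩ := hr
        obtain ⟨m, hm⟩ := p.2.1 l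
        have hm' : p.1.1.1 l = x₀ m := hm
        exact ⟨m, ⟨l, hl, hm'⟩, hm'.symm⟩
      · rintro ⟨m, hm, rfl⟩
        exact hm
    have hiff : ∀ n k, carve p.1.1 n = carve q.1.1 k ↔
        (fun m => decide (x₀ m ∈ carve p.1.1 n)) = fun m => decide (x₀ m ∈ carve q.1.1 k) := by
      intro n k
      refine ⟨fun h => by simp only [h], fun h => ?_⟩
      rw [key p n, key q k]
      simp only [fun m => congrFun h m]
    have h1 : relE p.1 q.1 ↔ jump (eqRel (Set ℝ)) (carve p.1.1) (carve q.1.1) :=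
      jump_eqRel_iff.symm
    refine h1.trans (and_congr ?_ ?_)
    · exact forall_congr' fun n => exists_congr fun k => hiff n k
    · exact forall_congr' fun n => exists_congr fun k =>
        eq_comm.trans ((hiff k n).trans eq_comm)

theorem jump_jump_reducible_relE : BorelReducible (jump (jump (eqRel ℝ))) relE := by
  classical
  -- All terms of all sequences are listed in one. The bits test membership of the real itself
  -- rather than of its index, which secures clause (3).
  let Φ : (ℕ → ℕ → ℝ) → (ℕ → ℝ) × (ℕ → ℕ → Bool) := fun u =>
    (fun i => u i.unpair.1 i.unpair.2, fun n i => decide (∃ j, u n j = u i.unpair.1 i.unpair.2))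
  have hm : ∀ n m, Measurable fun u : ℕ → ℕ → ℝ => u n m := fun n m =>
    (measurable_pi_apply m).comp (measurable_pi_apply n)
  have hΦ : Measurable Φ := by
    refine Measurable.prodMk (measurable_pi_lambda _ fun i => hm _ _)
      (measurable_pi_lambda _ fun n => measurable_pi_lambda _ fun i => measurable_to_bool ?_)
    have h : MeasurableSet (⋃ j, {u : ℕ → ℕ → ℝ | u n j = u i.unpair.1 i.unpair.2}) :=
      .iUnion fun j => measurableSet_eq_fun (hm _ _) (hm _ _)
    convert h using 1
    ext u
    simp
  have hP : ∀ u, Φ u ∈ setP := by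
    intro u
    refine ⟨fun m => ⟨m.unpair.1, ?_⟩, fun k => ⟨Nat.pair k 0, ?_⟩, fun k l₁ l₂ h => ?_⟩
    · simp [Φ]
    · simp [Φ]
    · have h' : u l₁.unpair.1 l₁.unpair.2 = u l₂.unpair.1 l₂.unpair.2 := h
      simp only [Φ, h']
  have hc : ∀ u, carve (Φ u) = fun n => range (u n) := by
    intro u
    funext n
    ext r
    simp only [carve, Φ, decide_eq_true_eq, mem_ofPred_eq, mem_range]
    constructor
    · rintro ⟨m, ⟨j, hj⟩, rfl⟩
      exact ⟨j, hj⟩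
    · rintro ⟨j, rfl⟩
      exact ⟨Nat.pair n j, ⟨j, by simp⟩, by simp⟩
  refine ⟨fun u => ⟨Φ u, hP u⟩, hΦ.subtype_mk, fun u v => ?_⟩
  rw [jump_jump_eqRel_iff, ← hc, ← hc]
  rfl

theorem prodRel_reducible_jump : BorelReducible (prodRel relF relG) (jump (eqRel ℝ)) := by
  let e := MeasureTheory.embeddingReal (ℝ × (ℕ → Bool) × Bool)
  have he := MeasureTheory.measurableEmbedding_embeddingReal (ℝ × (ℕ → Bool) × Bool)
  -- The last Boolean is a tag making the two copies disjoint, so that each range can be recovered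
  -- from the union; the other fillers are arbitrary.
  let φ : ℝ → ℝ := fun r => e (r, fun _ => false, true)
  let ψ : (ℕ → Bool) → ℝ := fun b => e (0, b, false)
  have hφ : Function.Injective φ := fun r s h => by simpa using he.injective h
  have hψ : Function.Injective ψ := fun r s h => by simpa using he.injective h
  have hφψ : ∀ r b, φ r ≠ ψ b := fun r b h => by simpa using he.injective h
  have hmφ : Measurable φ := he.measurable.comp (measurable_id.prodMk measurable_const)
  have hmψ : Measurable ψ :=
    he.measurable.comp (measurable_const.prodMk (measurable_id.prodMk measurable_const))
  let f : (ℕ → ℝ) × (ℕ → ℕ → Bool) → ℕ → ℝ := fun p i =>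
    if i % 2 = 0 then φ (p.1 (i / 2)) else ψ (p.2 (i / 2))
  have hr : ∀ p, range (f p) = φ '' range p.1 ∪ ψ '' range p.2 := by
    intro p
    ext r
    simp only [mem_range, mem_union, mem_image, exists_exists_eq_and]
    constructor
    · rintro ⟨i, rfl⟩
      by_cases hi : i % 2 = 0
      · exact .inl ⟨i / 2, by simp [f, hi]⟩
      · exact .inr ⟨i / 2, by simp only [f, hi, if_false]⟩
    · rintro (⟨n, rfl⟩ | ⟨n, rfl⟩)
      · exact ⟨2 * n, by simp [f]⟩
      · refine ⟨2 * n + 1, ?_⟩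
        have h1 : (2 * n + 1) % 2 = 1 := by omega
        have h2 : (2 * n + 1) / 2 = n := by omega
        simp [f, h1, h2]
  have hl : ∀ p, φ ⁻¹' range (f p) = range p.1 := by
    intro p
    rw [hr, preimage_union, preimage_image_eq _ hφ]
    refine union_eq_left.2 ?_
    rintro r ⟨b, -, hb⟩
    exact absurd hb.symm (hφψ r b)
  have hrr : ∀ p, ψ ⁻¹' range (f p) = range p.2 := by
    intro p
    rw [hr, preimage_union, preimage_image_eq _ hψ]
    refine union_eq_right.2 ?_
    rintro b ⟨r, -, hb⟩
    exact absurd hb (hφψ r b)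
  refine ⟨f, measurable_pi_lambda _ fun i => ?_, fun p q => ?_⟩
  · by_cases hi : i % 2 = 0
    · simp only [f, hi, if_true]
      exact hmφ.comp ((measurable_pi_apply _).comp measurable_fst)
    · simp only [f, hi, if_false]
      exact hmψ.comp ((measurable_pi_apply _).comp measurable_snd)
  · have h1 : prodRel relF relG p q ↔ range p.1 = range q.1 ∧ range p.2 = range q.2 :=
      and_congr jump_eqRel_iff jump_eqRel_iff
    rw [h1, jump_eqRel_iff]
    refine ⟨fun h => by rw [hr, hr, h.1, h.2], fun h => ⟨?_, ?_⟩⟩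
    · rw [← hl, ← hl, h]
    · rw [← hrr, ← hrr, h]

theorem not_relE_reducible : ¬ BorelReducible relE (prodRel relF relG) := fun h =>
  not_jump_jump_reducible_jump
    ((jump_jump_reducible_relE.trans h).trans prodRel_reducible_jump)

theorem isBorelEquiv_relF : IsBorelEquiv relF := isBorelEquiv_jump (isBorelEquiv_eqRel ℝ)

theorem isBorelEquiv_relG : IsBorelEquiv relG := isBorelEquiv_jump (isBorelEquiv_eqRel (ℕ → Bool))

theorem not_kanoveiZapletalConjecture : ¬ KanoveiZapletalConjecture := fun h =>
  have : PolishSpace Bool := inferInstance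
  have : TopologicalSpace.IsCompletelyMetrizableSpace (ℕ → ℕ → Bool) := inferInstance
  have : PolishSpace (ℕ → ℕ → Bool) := { }
  not_relE_reducible (h (ℕ → ℝ) (ℕ → ℕ → Bool) (ℕ → ℕ → Bool) setP relF relE relG
    isGδ_setP.measurableSet isBorelEquiv_relF isBorelEquiv_relE isBorelEquiv_relG relF_of_relE
    restrict_relE_reducible)

end KZ

theorem mainTheorem1 :
    -- `P` is a dense `G_δ` set
    IsGδ KZ.setP ∧ Dense KZ.setP ∧
    -- `E`, `F`, `G` are Borel equivalence relations
    KZ.IsBorelEquiv KZ.relF ∧ KZ.IsBorelEquiv KZ.relE ∧ KZ.IsBorelEquiv KZ.relG ∧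
    -- `E` projects to `F` in the first coordinate
    (∀ p q : KZ.setP, KZ.relE p q → KZ.relF p.1.1 q.1.1) ∧
    -- every restriction of `E` to an `F`-class is Borel reducible to `G`
    (∀ x₀ : ℕ → ℝ,
      KZ.BorelReducible (KZ.restrict KZ.relE {p : KZ.setP | KZ.relF p.1.1 x₀}) KZ.relG) ∧
    -- `((=_ℝ)⁺)⁺ ≤_B E`, `F × G ≤_B (=_ℝ)⁺` and `((=_ℝ)⁺)⁺ ≰_B (=_ℝ)⁺`
    KZ.BorelReducible (KZ.jump (KZ.jump (KZ.eqRel ℝ))) KZ.relE ∧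
    KZ.BorelReducible (KZ.prodRel KZ.relF KZ.relG) (KZ.jump (KZ.eqRel ℝ)) ∧
    ¬ KZ.BorelReducible (KZ.jump (KZ.jump (KZ.eqRel ℝ))) (KZ.jump (KZ.eqRel ℝ)) ∧
    -- `E` is not Borel reducible to `F × G`
    ¬ KZ.BorelReducible KZ.relE (KZ.prodRel KZ.relF KZ.relG) ∧
    -- the conjecture fails
    ¬ KZ.KanoveiZapletalConjecture :=
  ⟨KZ.isGδ_setP, KZ.dense_setP, KZ.isBorelEquiv_relF, KZ.isBorelEquiv_relE,
    KZ.isBorelEquiv_relG, KZ.relF_of_relE, KZ.restrict_relE_reducible,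
    KZ.jump_jump_reducible_relE, KZ.prodRel_reducible_jump, KZ.not_jump_jump_reducible_jump,
    KZ.not_relE_reducible, KZ.not_kanoveiZapletalConjecture⟩
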